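/- Let $K$ be a field of characteristic zero. For a field $F$ of characteristic zero, an $F$-variety is a separated integral scheme of finite type over $F$; a cover is a finite surjective morphism of normal $F$-varieties, and its degree is the degree of the associated extension of function fields. A subset $T\subseteq X(F)$, where $X$ is a normal $F$-variety, is called thin in $X$ if $$T\subseteq C(F)\cup\bigcup_{i=1}^r f_i(Z_i(F))$$ for some proper closed subscheme $C$ of $X$ and a finite (possibly empty) collection of covers $f_i\colon Z_i\to X$ of $F$-varieties with $\deg(f_i)>1$ for each $i$. A normal $F$-variety $X$ has the Hilbert property (HP) over $F$ if $X(F)$ is not thin in $X$. Let $p\colon\mathcal X\to S$ be a dominant morphism of normal $K$-varieties, let $K(S)$ be the function field of $S$, and let $X=\mathcal X\times_S\operatorname{Spec}K(S)$ be the generic fiber of $p$, considered as a scheme over $K(S)$. Assume that $S$ has HP over $K$, and that $X$ is normal and has HP over $K(S)$. Then $\mathcal X$ has HP over $K$. -/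

import Mathlib

universe u

open CategoryTheory CategoryTheory.Limits AlgebraicGeometry

namespace HilbertProperty

/-- A scheme is normal if all of its local rings are integrally closed domains. -/
def IsNormal (X : Scheme.{u}) : Prop :=
  ∀ x : X, IsDomain (X.presheaf.stalk x) ∧ IsIntegrallyClosed (X.presheaf.stalk x)

/-- The scheme `X` with structure morphism `s : X ⟶ Spec K` is a `K`-variety: an integral scheme,
separated and of finite type over `K`. -/
structure IsVariety {K : Type u} [Field K] {X : Scheme.{u}} (s : X ⟶ Spec (.of K)) : Prop where
  isIntegral : IsIntegral X
  isSeparated : IsSeparated s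
  locallyOfFiniteType : LocallyOfFiniteType s
  quasiCompact : QuasiCompact s

/-- The `K`-scheme `s : X ⟶ Spec K` is a normal `K`-variety. -/
structure IsNormalVariety {K : Type u} [Field K] {X : Scheme.{u}} (s : X ⟶ Spec (.of K)) :
    Prop extends IsVariety s where
  isNormal : IsNormal X

theorem map_genericPoint {Z X : Scheme.{u}} [IsIntegral Z] [IsIntegral X] (f : Z ⟶ X)
    [IsDominant f] : f (genericPoint Z) = genericPoint X := by
  have h := (genericPoint_spec Z).image f.continuous
  have h2 : closure (f '' Set.univ) = Set.univ := by
    rw [Set.image_univ]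
    exact f.denseRange.closure_range
  rw [h2] at h
  exact h.eq (genericPoint_spec X)

/-- The homomorphism of function fields `K(X) → K(Z)` induced by a dominant morphism `Z ⟶ X` of
integral schemes. -/
noncomputable def functionFieldMap {Z X : Scheme.{u}} [IsIntegral Z] [IsIntegral X] (f : Z ⟶ X)
    [IsDominant f] : X.functionField ⟶ Z.functionField :=
  X.presheaf.stalkSpecializes (specializes_of_eq (map_genericPoint f)) ≫
    f.stalkMap (genericPoint Z)

/-- The degree `[K(Z) : K(X)]` of a dominant morphism `Z ⟶ X` of integral schemes
(with value `0` if the field extension is infinite). -/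
noncomputable def degree {Z X : Scheme.{u}} [IsIntegral Z] [IsIntegral X] (f : Z ⟶ X)
    [IsDominant f] : ℕ :=
  letI := (functionFieldMap f).hom.toAlgebra
  Module.finrank X.functionField Z.functionField

/-- The morphism `f : Z ⟶ X` is a cover of the `K`-scheme `s : X ⟶ Spec K`: a finite surjective
morphism of normal `K`-varieties, where `Z` is a `K`-scheme through `f`. -/
structure IsCover {K : Type u} [Field K] {Z X : Scheme.{u}} (s : X ⟶ Spec (.of K)) (f : Z ⟶ X) :
    Prop where
  source : IsNormalVariety (f ≫ s)
  target : IsNormalVariety s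
  isFinite : IsFinite f
  surjective : Surjective f

/-- The degree of a cover. -/
noncomputable def IsCover.degree {K : Type u} [Field K] {Z X : Scheme.{u}}
    {s : X ⟶ Spec (.of K)} {f : Z ⟶ X} (h : IsCover s f) : ℕ :=
  haveI := h.source.isIntegral
  haveI := h.target.isIntegral
  haveI := h.surjective
  HilbertProperty.degree f

/-- The set `X(K)` of `K`-rational points of the `K`-scheme `s : X ⟶ Spec K`. -/
noncomputable def RationalPoint {K : Type u} [Field K] {X : Scheme.{u}} (s : X ⟶ Spec (.of K)) : Type u :=
  { x : Spec (.of K) ⟶ X // x ≫ s = 𝟙 (Spec (.of K)) }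

/-- The map `Z(K) → X(K)` induced by a morphism `f : Z ⟶ X` of `K`-schemes. -/
noncomputable def RationalPoint.map {K : Type u} [Field K] {Z X : Scheme.{u}} (s : X ⟶ Spec (.of K))
    (f : Z ⟶ X) (z : RationalPoint (f ≫ s)) : RationalPoint s :=
  ⟨z.1 ≫ f, by rw [Category.assoc]; exact z.2⟩

/-- A subset `T` of `X(K)` is thin in `X` if it is contained in `C(K) ∪ ⋃ⱼ fⱼ(Zⱼ(K))` for a proper
closed subscheme `C` of `X` and finitely many covers `fⱼ : Zⱼ ⟶ X` of degree `> 1`. -/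
def IsThin {K : Type u} [Field K] {X : Scheme.{u}} (s : X ⟶ Spec (.of K))
    (T : Set (RationalPoint s)) : Prop :=
  ∃ (C : Scheme.{u}) (i : C ⟶ X) (r : ℕ) (Z : Fin r → Scheme.{u}) (f : ∀ j, Z j ⟶ X)
    (hf : ∀ j, IsCover s (f j)),
    IsClosedImmersion i ∧ ¬ IsIso i ∧ (∀ j, 1 < (hf j).degree) ∧
      T ⊆ Set.range (RationalPoint.map s i) ∪ ⋃ j, Set.range (RationalPoint.map s (f j))

/-- The (normal) `K`-variety `s : X ⟶ Spec K` has the Hilbert property if `X(K)` is not thin. -/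
def HasHP {K : Type u} [Field K] {X : Scheme.{u}} (s : X ⟶ Spec (.of K)) : Prop :=
  ¬ IsThin s Set.univ

/-- The generic fiber of a morphism `p : X ⟶ S` to an integral scheme `S`: the base change of `p`
along `Spec K(S) ⟶ S`. -/
noncomputable def genericFiber {X S : Scheme.{u}} [IsIntegral S] (p : X ⟶ S) : Scheme.{u} :=
  pullback p (S.fromSpecStalk (genericPoint S))

/-- The structure morphism of the generic fiber over the function field `K(S)`. -/
noncomputable def genericFiberStructure {X S : Scheme.{u}} [IsIntegral S] (p : X ⟶ S) :
    genericFiber p ⟶ Spec (.of S.functionField) :=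
  pullback.snd p (S.fromSpecStalk (genericPoint S))

end HilbertProperty

/-! Suppose `X(K)` is covered by the points of a proper closed `C` and the images of covers `Z j ⟶
X` of degree > 1; then `S(K)` is shown to be thin. The projection from the generic fiber to `X` is a
flat preimmersion, hence an isomorphism on local rings (`isIso_stalkMap_of_flat_of_isPreimmersion`).
Therefore the `Z j` restrict to covers of the generic fiber of unchanged degree, `C` restricts to a
proper closed subscheme, and HP of the generic fiber gives a `K(S)`-point `x` avoiding all of them
(`exists_rationalPoint_genericFiber`).

The point `x` spreads out to a section `σ` of `p` over an open part of `S`, shrunk to an affine `V`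
on which `σ` misses `C`. For `s ∈ V(K)` the point `σ(s)` then lifts to some `Z j`, so `s` lifts to
the pullback `W j` of `Z j` along `σ`. This `W j` is finite over `V` and has no rational section,
because `x` does not lift to `Z j`. It may be reducible, non-reduced or non-normal.

Off a proper closed subset of `S`, a `K`-point of `W j` lies on an irreducible component dominating
`S`, and lifts to the normalization of `S` in the function field of that component
(`exists_covers_of_finite`). That normalization is a cover of `S`, of degree > 1 since degree 1
would give a rational section (`exists_cover_of_isPrime`). So finitely many covers and one proper
closed subset account for all of `S(K)`, against HP of `S`. -/

namespace HilbertProperty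

/-! ### Commutative algebra: clearing denominators and dominating components. -/

section Algebra

/-- A denominator in `D` is integral over `A`, so it divides a nonzero element of `A`. The product
of such elements over finitely many generators of `C` serves for all of `C`. -/
theorem exists_ne_zero_forall_smul_mem_range {A D C L : Type*} [CommRing A] [IsDomain A]
    [CommRing D] [IsDomain D] [Algebra A D] [Algebra.IsIntegral A D] [Field L] [Algebra D L]
    [IsFractionRing D L] [Algebra A L] [IsScalarTower A D L] [CommRing C] [Algebra A C]
    [Algebra C L] [IsScalarTower A C L] [Module.Finite A C] :
    ∃ a : A, a ≠ 0 ∧ ∀ c : C, ∃ d : D, algebraMap D L d = algebraMap A L a * algebraMap C L c := by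
  have key (c : C) : ∃ a : A, a ≠ 0 ∧
      ∃ d : D, algebraMap D L d = algebraMap A L a * algebraMap C L c := by
    obtain ⟨d, e, he, hde⟩ := IsFractionRing.div_surjective (A := D) (algebraMap C L c)
    obtain ⟨a, ha, b, hb⟩ := (Algebra.IsIntegral.isIntegral (R := A) e).isAlgebraic
      |>.exists_nonzero_dvd he
    refine ⟨a, ha, b * d, ?_⟩
    have he0 : algebraMap D L e ≠ 0 := by
      simpa using nonZeroDivisors.ne_zero he
    rw [IsScalarTower.algebraMap_apply A D L, hb, ← hde, map_mul, map_mul]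
    field_simp
  choose a ha d hd using key
  obtain ⟨s, hs⟩ := (inferInstance : Module.Finite A C).fg_top
  refine ⟨∏ c ∈ s, a c, Finset.prod_ne_zero_iff.mpr fun c _ ↦ ha c, fun c ↦ ?_⟩
  have hc : c ∈ Submodule.span A (s : Set C) := hs ▸ Submodule.mem_top
  induction hc using Submodule.span_induction with
  | mem c hc =>
    obtain ⟨b, hb⟩ := Finset.dvd_prod_of_mem a hc
    refine ⟨algebraMap A D b * d c, ?_⟩
    rw [map_mul, hd, hb, map_mul, ← IsScalarTower.algebraMap_apply]
    ring
  | zero => exact ⟨0, by simp⟩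
  | add x y _ _ hx hy =>
    obtain ⟨u, hu⟩ := hx
    obtain ⟨v, hv⟩ := hy
    exact ⟨u + v, by rw [map_add, map_add, hu, hv]; ring⟩
  | smul r x _ hx =>
    obtain ⟨u, hu⟩ := hx
    refine ⟨algebraMap A D r * u, ?_⟩
    rw [map_mul, hu, ← IsScalarTower.algebraMap_apply, Algebra.smul_def, map_mul,
      ← IsScalarTower.algebraMap_apply A C L]
    ring

/-- Ring homomorphisms to fields extend along a birational finite extension of domains, provided
that they do not vanish at a suitable nonzero element of the base ring. -/
theorem exists_ne_zero_forall_exists_ringHom {A D C L : Type*} [CommRing A] [IsDomain A]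
    [CommRing D] [IsDomain D] [Algebra A D] [Algebra.IsIntegral A D] [Field L] [Algebra D L]
    [IsFractionRing D L] [Algebra A L] [IsScalarTower A D L] [CommRing C] [Algebra A C]
    [Algebra C L] [IsScalarTower A C L] [Module.Finite A C] :
    ∃ a : A, a ≠ 0 ∧ ∀ (K : Type u) [Field K] (φ : D →+* K), φ (algebraMap A D a) ≠ 0 →
      ∃ ψ : C →+* K, ψ.comp (algebraMap A C) = φ.comp (algebraMap A D) := by
  obtain ⟨a, ha, h⟩ := exists_ne_zero_forall_smul_mem_range (A := A) (D := D) (C := C) (L := L)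
  choose d hd using h
  have hinj := IsFractionRing.injective D L
  refine ⟨a, ha, fun K _ φ hφ ↦ ⟨
    -- Here `d c` is the element `a * c` of `L`, viewed in `D`. Every identity needed is checked in
    -- `L`, into which `D` embeds.
    { toFun := fun c ↦ φ (d c) / φ (algebraMap A D a)
      map_one' := ?_
      map_mul' := fun x y ↦ ?_
      map_zero' := ?_
      map_add' := fun x y ↦ ?_ }, ?_⟩⟩
  · have : d 1 = algebraMap A D a := hinj (by
      rw [hd, ← IsScalarTower.algebraMap_apply]; simp)
    rw [this, div_self hφ]
  · have : d (x * y) * algebraMap A D a = d x * d y := hinj (by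
      simp only [map_mul, hd, ← IsScalarTower.algebraMap_apply]; ring)
    rw [div_mul_div_comm, ← map_mul φ (d x), ← this, map_mul]
    field_simp
  · have : d 0 = 0 := hinj (by simp [hd])
    simp [this]
  · have : d (x + y) = d x + d y := hinj (by simp only [map_add, hd]; ring)
    rw [this, map_add, add_div]
  · ext x
    have : d (algebraMap A C x) = algebraMap A D a * algebraMap A D x := hinj (by
      simp only [map_mul, hd, ← IsScalarTower.algebraMap_apply])
    simp [this, mul_div_cancel_left₀ _ hφ]

/-- Over a nonempty open subset of the base, each prime ideal of a Noetherian algebra contains a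
minimal prime ideal that contracts to zero. -/
theorem exists_ne_zero_forall_exists_minimalPrimes_le {A B : Type*} [CommRing A] [IsDomain A]
    [CommRing B] [IsNoetherianRing B] [Algebra A B] :
    ∃ a : A, a ≠ 0 ∧ ∀ P : Ideal B, P.IsPrime → algebraMap A B a ∉ P →
      ∃ q ∈ minimalPrimes B, q.comap (algebraMap A B) = ⊥ ∧ q ≤ P := by
  have hfin : (minimalPrimes B).Finite := minimalPrimes.finite_of_isNoetherianRing B
  -- A minimal prime not lying over zero meets the image of `A` in some nonzero `a`, so a prime
  -- avoiding `a` cannot contain it. The other primes impose no condition, whence the value 1.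
  have key (q : Ideal B) : ∃ a : A, a ≠ 0 ∧
      (q.comap (algebraMap A B) ≠ ⊥ → algebraMap A B a ∈ q) := by
    by_cases hq : q.comap (algebraMap A B) = ⊥
    · exact ⟨1, one_ne_zero, fun h ↦ absurd hq h⟩
    · obtain ⟨a, ha, ha0⟩ := Submodule.exists_mem_ne_zero_of_ne_bot hq
      exact ⟨a, ha0, fun _ ↦ ha⟩
  choose a ha haq using key
  refine ⟨∏ q ∈ hfin.toFinset, a q, Finset.prod_ne_zero_iff.mpr fun q _ ↦ ha q,
    fun P hP haP ↦ ?_⟩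
  obtain ⟨q, hq, hqP⟩ := Ideal.exists_minimalPrimes_le (I := ⊥) (J := P) bot_le
  refine ⟨q, hq, ?_, hqP⟩
  by_contra hne
  refine haP (Ideal.mem_of_dvd P ?_ (hqP (haq q hne)))
  exact map_dvd _ (Finset.dvd_prod_of_mem a (hfin.mem_toFinset.mpr hq))

end Algebra

/-! ### Flat preimmersions preserve local rings, hence integrality, normality and function fields.
-/

section FlatPreimmersion

instance flat_fromSpecStalk (X : Scheme.{u}) (x : X) : Flat (X.fromSpecStalk x) := by
  obtain ⟨_, ⟨U, hU, rfl⟩, hxU, -⟩ :=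
    X.isBasis_affineOpens.exists_subset_of_mem_open (Set.mem_univ x) isOpen_univ
  rw [← hU.fromSpecStalk_eq_fromSpecStalk hxU]
  have : Flat (Spec.map (X.presheaf.germ U x hxU)) := by
    rw [Flat.SpecMap_iff]
    let := TopCat.Presheaf.algebra_section_stalk X.presheaf ⟨x, hxU⟩
    have := hU.isLocalization_stalk ⟨x, hxU⟩
    exact IsLocalization.flat (X.presheaf.stalk x) (hU.primeIdealOf ⟨x, hxU⟩).asIdeal.primeCompl
  have : IsOpenImmersion hU.fromSpec := hU.isOpenImmersion_fromSpec
  exact Flat.comp (Spec.map (X.presheaf.germ U x hxU)) hU.fromSpec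

variable {X Y : Scheme.{u}} (g : Y ⟶ X) [Flat g] [IsPreimmersion g]

/-- A flat local homomorphism is faithfully flat, hence injective; a preimmersion is surjective on
stalks. -/
theorem isIso_stalkMap_of_flat_of_isPreimmersion (y : Y) : IsIso (g.stalkMap y) := by
  have hflat := Flat.stalkMap g y
  have hsurj := g.stalkMap_surjective y
  have hinj : Function.Injective (g.stalkMap y) := by
    algebraize [(g.stalkMap y).hom]
    have : IsLocalHom (algebraMap (X.presheaf.stalk (g y)) (Y.presheaf.stalk y)) :=
      inferInstanceAs (IsLocalHom (g.stalkMap y).hom)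
    have := Module.FaithfullyFlat.of_flat_of_isLocalHom (A := X.presheaf.stalk (g y))
      (B := Y.presheaf.stalk y)
    exact FaithfulSMul.algebraMap_injective (X.presheaf.stalk (g y)) (Y.presheaf.stalk y)
  exact (ConcreteCategory.isIso_iff_bijective (g.stalkMap y)).mpr ⟨hinj, hsurj⟩

theorem IsNormal.of_flat_of_isPreimmersion {X Y : Scheme.{u}} (g : Y ⟶ X) [Flat g]
    [IsPreimmersion g] (hX : IsNormal X) : IsNormal Y := fun y ↦ by
  have := isIso_stalkMap_of_flat_of_isPreimmersion g y
  let e := (asIso (g.stalkMap y)).commRingCatIsoToRingEquiv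
  have := (hX (g y)).1
  have := (hX (g y)).2
  exact ⟨e.symm.toMulEquiv.isDomain _, .of_equiv e⟩

theorem isDominant_of_genericPoint_mem_range {X Y : Scheme.{u}} (g : Y ⟶ X) [IsIntegral X]
    (hg : genericPoint X ∈ Set.range g) : IsDominant g := by
  refine ⟨dense_iff_closure_eq.mpr (Set.univ_subset_iff.mp ?_)⟩
  rw [← (genericPoint_spec X).def]
  exact closure_mono (Set.singleton_subset_iff.mpr hg)

theorem isIntegral_of_flat_of_isPreimmersion [IsIntegral X]
    (hg : genericPoint X ∈ Set.range g) : IsIntegral Y := by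
  obtain ⟨y, hy⟩ := hg
  have hred : IsReduced Y := by
    have (y : Y) : _root_.IsReduced (Y.presheaf.stalk y) := by
      have := isIso_stalkMap_of_flat_of_isPreimmersion g y
      exact isReduced_of_injective (inv (g.stalkMap y)).hom
        (ConcreteCategory.bijective_of_isIso (inv (g.stalkMap y))).1
    exact isReduced_of_isReduced_stalk Y
  have hgen : closure {y} = (Set.univ : Set Y) := by
    rw [g.isEmbedding.closure_eq_preimage_closure_image, Set.image_singleton, hy,
      (genericPoint_spec X).def]
    simp
  have : IrreducibleSpace Y := by
    rw [irreducibleSpace_def, Set.top_eq_univ, ← hgen]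
    exact isIrreducible_singleton.closure
  exact isIntegral_of_irreducibleSpace_of_isReduced Y

theorem isIso_functionFieldMap_of_flat_of_isPreimmersion [IsIntegral X] [IsIntegral Y]
    [IsDominant g] : IsIso (functionFieldMap g) := by
  have := isIso_stalkMap_of_flat_of_isPreimmersion g (genericPoint Y)
  unfold functionFieldMap
  have : IsIso (X.presheaf.stalkSpecializes (specializes_of_eq (map_genericPoint g))) :=
    (X.presheaf.stalkCongr (.of_eq (map_genericPoint g).symm)).isIso_hom
  infer_instance

end FlatPreimmersion

/-! ### Invariance of the degree of a cover under base change to the generic fiber. -/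

section FunctionField

theorem functionFieldMap_comp {X Y Z : Scheme.{u}} [IsIntegral X] [IsIntegral Y] [IsIntegral Z]
    (f : X ⟶ Y) (g : Y ⟶ Z) [IsDominant f] [IsDominant g] :
    functionFieldMap (f ≫ g) = functionFieldMap g ≫ functionFieldMap f := by
  unfold functionFieldMap
  rw [Scheme.Hom.stalkMap_comp]
  simp [← Scheme.Hom.stalkSpecializes_stalkMap_assoc]

theorem degree_eq_of_comp_eq {X Y X' Y' : Scheme.{u}} [IsIntegral X] [IsIntegral Y]
    [IsIntegral X'] [IsIntegral Y'] (f : Y ⟶ X) (f' : Y' ⟶ X') (g : Y' ⟶ Y) (h : X' ⟶ X)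
    [IsDominant f] [IsDominant f'] [IsDominant g] [IsDominant h]
    [IsIso (functionFieldMap g)] [IsIso (functionFieldMap h)] (H : g ≫ f = f' ≫ h) :
    degree f' = degree f := by
  have H' : functionFieldMap f ≫ functionFieldMap g =
      functionFieldMap h ≫ functionFieldMap f' := by
    rw [← functionFieldMap_comp, ← functionFieldMap_comp]
    congr
  let := (functionFieldMap f).hom.toAlgebra
  let := (functionFieldMap f').hom.toAlgebra
  refine (Algebra.finrank_eq_of_equiv_equiv
    (asIso (functionFieldMap h)).commRingCatIsoToRingEquiv
    (asIso (functionFieldMap g)).commRingCatIsoToRingEquiv ?_).symm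
  exact congr(($H').hom).symm

end FunctionField

/-- A closed set containing the generic point is everything, and `X` is reduced. Properness of a
closed subscheme is thus tested at the generic point. -/
theorem isIso_of_genericPoint_mem_range {X C : Scheme.{u}} [IsIntegral X] (i : C ⟶ X)
    [IsClosedImmersion i] (h : genericPoint X ∈ Set.range i) : IsIso i := by
  have : Surjective i := ⟨by
    rw [← Set.range_eq_univ, ← i.isClosedEmbedding.isClosed_range.closure_eq]
    exact (isDominant_of_genericPoint_mem_range i h).denseRange.closure_range⟩
  exact isIso_of_isClosedImmersion_of_surjective i

theorem exists_rationalPoint_genericFiber {K : Type u} [Field K] {X S : Scheme.{u}} [IsIntegral S]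
    {sX : X ⟶ Spec (.of K)} (hX : IsNormalVariety sX) (p : X ⟶ S) [IsDominant p]
    [LocallyOfFiniteType p] [QuasiCompact p] [IsSeparated p]
    (hnormal : IsNormal (genericFiber p)) (hHP : HasHP (genericFiberStructure p))
    {C : Scheme.{u}} (i : C ⟶ X) [IsClosedImmersion i] (hi : ¬ IsIso i) {r : ℕ}
    {Z : Fin r → Scheme.{u}} (f : ∀ j, Z j ⟶ X) (hf : ∀ j, IsCover sX (f j))
    (hdeg : ∀ j, 1 < (hf j).degree) :
    ∃ x : Spec S.functionField ⟶ X, x ≫ p = S.fromSpecStalk (genericPoint S) ∧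
      (∀ c, c ≫ i ≠ x) ∧ ∀ j z, z ≫ f j ≠ x := by
  have := hX.isIntegral
  let g : genericFiber p ⟶ X := pullback.fst p (S.fromSpecStalk (genericPoint S))
  have hg1 : Flat g := inferInstanceAs (Flat (pullback.fst _ _))
  have hg2 : IsPreimmersion g := inferInstanceAs (IsPreimmersion (pullback.fst _ _))
  have hgX : genericPoint X ∈ Set.range g := by
    refine (Scheme.Pullback.range_fst p (S.fromSpecStalk (genericPoint S))).ge ?_
    exact ⟨_, Scheme.fromSpecStalk_closedPoint.trans (map_genericPoint p).symm⟩
  have hint : IsIntegral (genericFiber p) := isIntegral_of_flat_of_isPreimmersion g hgX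
  have hgdom : IsDominant g := isDominant_of_genericPoint_mem_range g hgX
  have hgiso := isIso_functionFieldMap_of_flat_of_isPreimmersion g
  have hs1 : LocallyOfFiniteType (genericFiberStructure p) :=
    inferInstanceAs (LocallyOfFiniteType (pullback.snd _ _))
  have hs2 : QuasiCompact (genericFiberStructure p) :=
    inferInstanceAs (QuasiCompact (pullback.snd _ _))
  have hs3 : IsSeparated (genericFiberStructure p) :=
    inferInstanceAs (IsSeparated (pullback.snd _ _))
  have hcov (j : Fin r) : ∃ h : IsCover (genericFiberStructure p) (pullback.snd (f j) g),
      1 < h.degree := by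
    have := (hf j).source.isIntegral
    have := (hf j).surjective
    have := (hf j).isFinite
    have hdom : IsDominant (f j) := inferInstance
    -- `f j` carries generic point to generic point, and that of `X` lies in the generic fiber. So
    -- the base change of `Z j` is again integral with the same function field.
    have hgZ : genericPoint (Z j) ∈ Set.range (pullback.fst (f j) g) := by
      rw [Scheme.Pullback.range_fst, Set.mem_preimage, map_genericPoint]
      exact hgX
    have := isIntegral_of_flat_of_isPreimmersion _ hgZ
    have := isDominant_of_genericPoint_mem_range _ hgZ
    have := isIso_functionFieldMap_of_flat_of_isPreimmersion (pullback.fst (f j) g)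
    have hc : IsCover (genericFiberStructure p) (pullback.snd (f j) g) :=
      { source :=
          { isIntegral := inferInstance
            isSeparated := inferInstance
            locallyOfFiniteType := inferInstance
            quasiCompact := inferInstance
            isNormal := (hf j).source.isNormal.of_flat_of_isPreimmersion (pullback.fst (f j) g) }
        target := ⟨⟨hint, hs3, hs1, hs2⟩, hnormal⟩
        isFinite := inferInstance
        surjective := inferInstance }
    refine ⟨hc, (hdeg j).trans_eq ?_⟩
    exact (degree_eq_of_comp_eq (f j) (pullback.snd (f j) g) (pullback.fst (f j) g) g
      pullback.condition).symm
  choose hc hcdeg using hcov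
  have hne : ¬ IsIso (pullback.snd i g) := fun h ↦ hi <| by
    refine isIso_of_genericPoint_mem_range i ?_
    obtain ⟨y, hy⟩ := hgX
    refine ⟨(inv (pullback.snd i g) ≫ pullback.fst i g) y, ?_⟩
    rw [← hy, ← Scheme.Hom.comp_apply, Category.assoc, pullback.condition,
      IsIso.inv_hom_id_assoc]
  have hnot : ¬ (Set.univ ⊆ _) := fun h ↦
    hHP ⟨_, pullback.snd i g, r, _, _, hc, inferInstance, hne, hcdeg, h⟩
  obtain ⟨x, -, hx⟩ := Set.not_subset.mp hnot
  rw [Set.mem_union, not_or, Set.mem_iUnion, not_exists] at hx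
  have hxs := x.2
  refine ⟨x.1 ≫ g, ?_, fun c h ↦ hx.1 ?_, fun j z h ↦ hx.2 j ?_⟩
  · have hgp : g ≫ p = genericFiberStructure p ≫ S.fromSpecStalk (genericPoint S) :=
      pullback.condition
    rw [Category.assoc, hgp]
    exact (reassoc_of% hxs) _
  · refine ⟨⟨pullback.lift c x.1 h, ?_⟩, Subtype.ext (pullback.lift_snd _ _ _)⟩
    rw [pullback.lift_snd_assoc]
    exact x.2
  · refine ⟨⟨pullback.lift z x.1 h, ?_⟩, Subtype.ext (pullback.lift_snd _ _ _)⟩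
    rw [pullback.lift_snd_assoc]
    exact x.2

/-! ### Normalization of `S` in an extension of its function field. -/

section Normalization

/-- `W` is a variable so that it can be `⊤`, which in the application equals `f ⁻¹ᵁ V` only
propositionally. -/
theorem toNormalization_appLE_injective {X Y : Scheme.{u}} (f : X ⟶ Y) [QuasiCompact f]
    [QuasiSeparated f] {V : Y.Opens} (hV : IsAffineOpen V) {W : X.Opens} (hW : W = f ⁻¹ᵁ V)
    (e : W ≤ f.toNormalization ⁻¹ᵁ f.fromNormalization ⁻¹ᵁ V) :
    Function.Injective (f.toNormalization.appLE _ W e) := by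
  subst hW
  let := (f.app V).hom.toAlgebra
  rw [← f.normalizationObjIso_hom_val hV]
  exact Subtype.val_injective.comp
    (ConcreteCategory.bijective_of_isIso (f.normalizationObjIso hV).hom).1

theorem exists_toNormalization_appLE_eq {X Y : Scheme.{u}} (f : X ⟶ Y) [QuasiCompact f]
    [QuasiSeparated f] {V : Y.Opens} (hV : IsAffineOpen V) {W : X.Opens} (hW : W = f ⁻¹ᵁ V)
    (e : W ≤ f.toNormalization ⁻¹ᵁ f.fromNormalization ⁻¹ᵁ V) (y : Γ(X, W))
    (hy : (f.appLE V W hW.le).hom.IsIntegralElem y) :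
    ∃ c, f.toNormalization.appLE _ W e c = y := by
  subst hW
  let := (f.app V).hom.toAlgebra
  rw [← Scheme.Hom.app_eq_appLE] at hy
  obtain ⟨c, hc⟩ := (ConcreteCategory.bijective_of_isIso (f.normalizationObjIso hV).hom).2 ⟨y, hy⟩
  refine ⟨c, ?_⟩
  rw [← f.normalizationObjIso_hom_val hV]
  exact congrArg Subtype.val hc

theorem SpecMap_fromSpecStalk_appLE {X : Scheme.{u}} {x : X} {R : CommRingCat.{u}}
    (φ : X.presheaf.stalk x ⟶ R) {V : X.Opens} (hx : x ∈ V)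
    (e : ⊤ ≤ (Spec.map φ ≫ X.fromSpecStalk x) ⁻¹ᵁ V) :
    (Spec.map φ ≫ X.fromSpecStalk x).appLE V ⊤ e ≫ (Scheme.ΓSpecIso R).hom =
      X.presheaf.germ V x hx ≫ φ := by
  have e' : ⊤ ≤ Spec.map φ ⁻¹ᵁ X.fromSpecStalk x ⁻¹ᵁ V := e
  have key : (Spec _).presheaf.map (homOfLE le_top).op ≫ (Spec.map φ).appLE _ ⊤ e' =
      (Spec.map φ).appTop := by
    rw [Scheme.Hom.map_appLE]
    exact Scheme.Hom.appLE_eq_app _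
  rw [Scheme.Hom.comp_appLE, Scheme.fromSpecStalk_app hx]
  simp only [Category.assoc]
  rw [reassoc_of% key, Scheme.ΓSpecIso_naturality, Iso.inv_hom_id_assoc]

variable (S : Scheme.{u}) [IsIntegral S] (L : Type u) [Field L] [Algebra S.functionField L]

/-- The inclusion of the function field of `S` in an extension field. -/
noncomputable def extensionHom : S.functionField ⟶ .of L :=
  CommRingCat.ofHom (algebraMap S.functionField L)

/-- The morphism to `S` from the spectrum of an extension of its function field. -/
noncomputable def specExtension : Spec (.of L) ⟶ S :=
  Spec.map (extensionHom S L) ≫ S.fromSpecStalk (genericPoint S)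

theorem specExtension_apply (x : Spec (.of L)) : specExtension S L x = genericPoint S := by
  have h : S.fromSpecStalk (genericPoint S) (Spec.map (extensionHom S L) x) ⤳ genericPoint S := by
    have := Set.mem_range_self (f := S.fromSpecStalk (genericPoint S))
      (Spec.map (extensionHom S L) x)
    rwa [Scheme.range_fromSpecStalk] at this
  exact (h.antisymm (genericPoint_specializes _)).eq

theorem specExtension_preimage {V : S.Opens} (hV : genericPoint S ∈ V) :
    specExtension S L ⁻¹ᵁ V = ⊤ := by
  refine top_unique fun x _ ↦ ?_
  change specExtension S L x ∈ V
  rwa [specExtension_apply]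

/-- The normalization of `S` in a finite extension of its function field. -/
noncomputable abbrev normalizationIn : Scheme.{u} := (specExtension S L).normalization

/-- The morphism from the normalization of `S` in an extension of its function field to `S`. -/
noncomputable abbrev fromNormalizationIn : normalizationIn S L ⟶ S :=
  (specExtension S L).fromNormalization

instance : IsIntegral (normalizationIn S L) :=
  inferInstanceAs (IsIntegral (specExtension S L).normalization)

instance : IsIntegralHom (fromNormalizationIn S L) :=
  inferInstanceAs (IsIntegralHom (specExtension S L).fromNormalization)

theorem genericPoint_mem_range_fromNormalizationIn :
    genericPoint S ∈ Set.range (fromNormalizationIn S L) := by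
  obtain ⟨x⟩ : Nonempty (Spec (.of L)) := inferInstance
  refine ⟨(specExtension S L).toNormalization x, ?_⟩
  rw [← Scheme.Hom.comp_apply, Scheme.Hom.toNormalization_fromNormalization, specExtension_apply]

variable {S L}

/-- The inclusion in `L` of the ring of sections of the normalization of `S` in `L`. -/
noncomputable def normalizationInSections {V : S.Opens} (hV : genericPoint S ∈ V) :
    Γ(normalizationIn S L, fromNormalizationIn S L ⁻¹ᵁ V) →+* L :=
  ((specExtension S L).toNormalization.appLE (fromNormalizationIn S L ⁻¹ᵁ V) ⊤ (by
    unfold fromNormalizationIn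
    rw [← Scheme.Hom.comp_preimage, Scheme.Hom.toNormalization_fromNormalization,
      specExtension_preimage S L hV]) ≫ (Scheme.ΓSpecIso (.of L)).hom).hom

theorem specExtension_appLE {V : S.Opens} (hV : genericPoint S ∈ V) :
    (specExtension S L).appLE V ⊤ (specExtension_preimage S L hV).ge ≫
      (Scheme.ΓSpecIso (.of L)).hom = S.presheaf.germ V (genericPoint S) hV ≫
        extensionHom S L :=
  SpecMap_fromSpecStalk_appLE _ hV _

theorem normalizationInSections_comp {V : S.Opens} (hV : genericPoint S ∈ V) :
    (normalizationInSections (L := L) hV).comp ((fromNormalizationIn S L).app V).hom =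
      (algebraMap S.functionField L).comp (S.presheaf.germ V (genericPoint S) hV).hom := by
  have h := specExtension_appLE (L := L) hV
  rw [normalizationInSections, ← CommRingCat.hom_comp]
  refine Eq.trans ?_ congr(($h).hom)
  congr 1
  rw [← Category.assoc]
  congr 1
  rw [Scheme.Hom.app_eq_appLE, Scheme.Hom.appLE_comp_appLE]
  congr 1
  exact Scheme.Hom.toNormalization_fromNormalization _

theorem normalizationInSections_injective {V : S.Opens} (hVa : IsAffineOpen V)
    (hV : genericPoint S ∈ V) : Function.Injective (normalizationInSections (L := L) hV) :=
  (ConcreteCategory.bijective_of_isIso (Scheme.ΓSpecIso (.of L)).hom).1.comp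
    (toNormalization_appLE_injective (specExtension S L) hVa
      (specExtension_preimage S L hV).symm _)

theorem exists_normalizationInSections_eq {V : S.Opens} (hVa : IsAffineOpen V)
    (hV : genericPoint S ∈ V) (y : L)
    (hy : ((algebraMap S.functionField L).comp
      (S.presheaf.germ V (genericPoint S) hV).hom).IsIntegralElem y) :
    ∃ c, normalizationInSections hV c = y := by
  obtain ⟨z, hz⟩ := (ConcreteCategory.bijective_of_isIso (Scheme.ΓSpecIso (.of L)).hom).2 y
  obtain ⟨c, hc⟩ := exists_toNormalization_appLE_eq (specExtension S L) hVa
    (specExtension_preimage S L hV).symm (by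
      rw [← Scheme.Hom.comp_preimage, Scheme.Hom.toNormalization_fromNormalization,
        specExtension_preimage S L hV]) z (by
      refine RingHom.IsIntegralElem.of_map (g := (Scheme.ΓSpecIso (.of L)).hom.hom)
        (ConcreteCategory.bijective_of_isIso (Scheme.ΓSpecIso (.of L)).hom).1 ?_
      rw [← CommRingCat.hom_comp, specExtension_appLE]
      exact hz ▸ hy)
  refine ⟨c, ?_⟩
  rw [← hz, ← hc]
  rfl

end Normalization

/-! ### Normality on affine open sets. -/

section Normal

theorem IsNormal.isIntegrallyClosed {X : Scheme.{u}} [IsIntegral X] (hX : IsNormal X)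
    {V : X.Opens} (hV : IsAffineOpen V) [Nonempty V] : IsIntegrallyClosed Γ(X, V) := by
  refine IsIntegrallyClosed.of_localization_maximal fun P _ hP ↦ ?_
  let y : PrimeSpectrum Γ(X, V) := ⟨P, hP.isPrime⟩
  have hy : hV.fromSpec y ∈ V := by
    have := Set.mem_range_self (f := hV.fromSpec) y
    rwa [hV.range_fromSpec] at this
  let := X.presheaf.algebra_section_stalk ⟨hV.fromSpec y, hy⟩
  have hloc : IsLocalization.AtPrime (X.presheaf.stalk (hV.fromSpec y)) P :=
    hV.isLocalization_stalk' y hy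
  have := (hX (hV.fromSpec y)).2
  exact .of_equiv (IsLocalization.algEquiv P.primeCompl (X.presheaf.stalk (hV.fromSpec y))
    (Localization.AtPrime P)).toRingEquiv

theorem IsNormal.of_isIntegrallyClosed {X : Scheme.{u}} [IsIntegral X]
    (h : ∀ x : X, ∃ V : X.Opens, x ∈ V ∧ IsAffineOpen V ∧ IsIntegrallyClosed Γ(X, V)) :
    IsNormal X := fun x ↦ by
  obtain ⟨V, hx, hV, hc⟩ := h x
  have : Nonempty V := ⟨⟨x, hx⟩⟩
  let := X.presheaf.algebra_section_stalk ⟨x, hx⟩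
  have hloc := hV.isLocalization_stalk ⟨x, hx⟩
  exact ⟨inferInstance, isIntegrallyClosed_of_isLocalization (X.presheaf.stalk x)
    (hV.primeIdealOf ⟨x, hx⟩).asIdeal.primeCompl (Ideal.primeCompl_le_nonZeroDivisors _)⟩

end Normal

theorem germ_functionFieldMap {Z X : Scheme.{u}} [IsIntegral Z] [IsIntegral X] (f : Z ⟶ X)
    [IsDominant f] (V : X.Opens) (hV : genericPoint X ∈ V) :
    X.presheaf.germ V (genericPoint X) hV ≫ functionFieldMap f =
      f.app V ≫ Z.presheaf.germ (f ⁻¹ᵁ V) (genericPoint Z)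
        (by rwa [← map_genericPoint f] at hV) := by
  rw [functionFieldMap, TopCat.Presheaf.germ_stalkSpecializes_assoc, Scheme.Hom.germ_stalkMap]

/-! ### The normalization in a finite extension is a cover of the expected degree. -/

section NormalizationAlgebra

variable {S : Scheme.{u}} [IsIntegral S] {L : Type u} [Field L] [Algebra S.functionField L]
  {V : S.Opens}

theorem genericPoint_mem_of_nonempty (V : S.Opens) [h : Nonempty V] : genericPoint S ∈ V :=
  ((genericPoint_spec S).mem_open_set_iff V.isOpen).mpr (by simpa using h)

variable (L V) in
/-- An extension of the function field as an algebra over the ring of sections of an open set. -/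
@[reducible]
noncomputable def sectionsAlgebra [Nonempty V] : Algebra Γ(S, V) L :=
  ((algebraMap S.functionField L).comp (algebraMap Γ(S, V) S.functionField)).toAlgebra

variable (L V) in
/-- The ring of sections of the normalization as an algebra over the ring of sections of the
base. -/
@[reducible]
noncomputable def normalizationInAlgebra :
    Algebra Γ(S, V) Γ(normalizationIn S L, fromNormalizationIn S L ⁻¹ᵁ V) :=
  ((fromNormalizationIn S L).app V).hom.toAlgebra

variable (L V) in
/-- An extension of the function field as an algebra over the ring of sections of the
normalization. -/
@[reducible]
noncomputable def normalizationInSectionsAlgebra [Nonempty V] :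
    Algebra Γ(normalizationIn S L, fromNormalizationIn S L ⁻¹ᵁ V) L :=
  (normalizationInSections (genericPoint_mem_of_nonempty V)).toAlgebra

attribute [local instance] sectionsAlgebra normalizationInAlgebra normalizationInSectionsAlgebra

instance isScalarTower_sections [Nonempty V] : IsScalarTower Γ(S, V) S.functionField L :=
  .of_algebraMap_eq' rfl

instance isScalarTower_normalizationIn [Nonempty V] :
    IsScalarTower Γ(S, V) Γ(normalizationIn S L, fromNormalizationIn S L ⁻¹ᵁ V) L :=
  .of_algebraMap_eq' (normalizationInSections_comp (genericPoint_mem_of_nonempty V)).symm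

theorem isIntegralClosure_normalizationIn [Nonempty V] (hV : IsAffineOpen V) :
    IsIntegralClosure Γ(normalizationIn S L, fromNormalizationIn S L ⁻¹ᵁ V) Γ(S, V) L where
  algebraMap_injective := normalizationInSections_injective hV (genericPoint_mem_of_nonempty V)
  isIntegral_iff := by
    refine fun {x} ↦ ⟨exists_normalizationInSections_eq hV (genericPoint_mem_of_nonempty V) x, ?_⟩
    rintro ⟨c, rfl⟩
    have : Algebra.IsIntegral Γ(S, V) Γ(normalizationIn S L, fromNormalizationIn S L ⁻¹ᵁ V) :=
      ⟨(fromNormalizationIn S L).isIntegral_app V hV⟩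
    exact (Algebra.IsIntegral.isIntegral c).algebraMap

instance nonempty_fromNormalizationIn_preimage [Nonempty V] :
    Nonempty (fromNormalizationIn S L ⁻¹ᵁ V) := by
  obtain ⟨x, hx⟩ := genericPoint_mem_range_fromNormalizationIn S L
  exact ⟨⟨x, by simpa [hx] using genericPoint_mem_of_nonempty V⟩⟩

theorem isFractionRing_normalizationIn [Nonempty V] (hV : IsAffineOpen V)
    [FiniteDimensional S.functionField L] :
    IsFractionRing Γ(normalizationIn S L, fromNormalizationIn S L ⁻¹ᵁ V) L := by
  have := isIntegralClosure_normalizationIn (L := L) hV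
  have := functionField_isFractionRing_of_isAffineOpen S V hV
  exact IsIntegralClosure.isFractionRing_of_finite_extension Γ(S, V) S.functionField L _

theorem isNormal_normalizationIn [FiniteDimensional S.functionField L] :
    IsNormal (normalizationIn S L) := by
  refine .of_isIntegrallyClosed fun x ↦ ?_
  obtain ⟨_, ⟨V, hV, rfl⟩, hxV, -⟩ := S.isBasis_affineOpens.exists_subset_of_mem_open
    (Set.mem_univ (fromNormalizationIn S L x)) isOpen_univ
  have : Nonempty V := ⟨⟨_, hxV⟩⟩
  refine ⟨fromNormalizationIn S L ⁻¹ᵁ V, hxV, hV.preimage _, ?_⟩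
  have := isIntegralClosure_normalizationIn (L := L) hV
  have := isFractionRing_normalizationIn (L := L) hV
  have : IsIntegrallyClosedIn Γ(normalizationIn S L, fromNormalizationIn S L ⁻¹ᵁ V) L :=
    .of_isIntegralClosure Γ(S, V)
  exact .of_isIntegrallyClosedIn _ L

/-- Characteristic zero makes the extension separable, so the integral closure of a Noetherian
integrally closed domain in it is finite. -/
theorem finite_normalizationIn [Nonempty V] (hV : IsAffineOpen V) (hS : IsNormal S)
    [IsLocallyNoetherian S] [CharZero S.functionField] [FiniteDimensional S.functionField L] :
    Module.Finite Γ(S, V) Γ(normalizationIn S L, fromNormalizationIn S L ⁻¹ᵁ V) := by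
  have := isIntegralClosure_normalizationIn (L := L) hV
  have := functionField_isFractionRing_of_isAffineOpen S V hV
  have := hS.isIntegrallyClosed hV
  have : IsNoetherianRing Γ(S, V) := IsLocallyNoetherian.component_noetherian ⟨V, hV⟩
  exact IsIntegralClosure.finite Γ(S, V) S.functionField L _

theorem isFinite_fromNormalizationIn (hS : IsNormal S) [IsLocallyNoetherian S]
    [CharZero S.functionField] [FiniteDimensional S.functionField L] :
    IsFinite (fromNormalizationIn S L) := by
  refine ⟨fun V hV ↦ ?_⟩
  rcases isEmpty_or_nonempty V with h | h
  · refine RingHom.Finite.of_surjective _ fun c ↦ ⟨0, ?_⟩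
    have : V = ⊥ := by
      ext x
      simpa using fun hx ↦ h.false ⟨x, hx⟩
    subst this
    have : Subsingleton Γ(normalizationIn S L, fromNormalizationIn S L ⁻¹ᵁ ⊥) :=
      inferInstanceAs (Subsingleton Γ(normalizationIn S L, ⊥))
    exact Subsingleton.elim _ _
  · exact finite_normalizationIn hV hS

instance isDominant_fromNormalizationIn : IsDominant (fromNormalizationIn S L) :=
  isDominant_of_genericPoint_mem_range _ (genericPoint_mem_range_fromNormalizationIn S L)

theorem surjective_fromNormalizationIn : Surjective (fromNormalizationIn S L) := by
  refine ⟨Set.range_eq_univ.mp ?_⟩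
  rw [← (fromNormalizationIn S L).isClosedMap.isClosed_range.closure_eq]
  exact (fromNormalizationIn S L).denseRange.closure_range

/-- Over an affine `V`, both `L` and the function field of the normalization are fraction fields of
the same ring; compatibility over `K(S)` is checked on `Γ(S, V)`. -/
theorem degree_fromNormalizationIn [FiniteDimensional S.functionField L] :
    degree (fromNormalizationIn S L) = Module.finrank S.functionField L := by
  obtain ⟨_, ⟨V, hV, rfl⟩, hV', -⟩ := S.isBasis_affineOpens.exists_subset_of_mem_open
    (Set.mem_univ (genericPoint S)) isOpen_univ
  have : Nonempty V := ⟨⟨_, hV'⟩⟩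
  have := isFractionRing_normalizationIn (L := L) hV
  have := functionField_isFractionRing_of_isAffineOpen S V hV
  have := functionField_isFractionRing_of_isAffineOpen (normalizationIn S L)
    (fromNormalizationIn S L ⁻¹ᵁ V) (hV.preimage _)
  let e : (normalizationIn S L).functionField ≃+* L :=
    (IsLocalization.algEquiv (nonZeroDivisors Γ(normalizationIn S L, fromNormalizationIn S L ⁻¹ᵁ V))
      (normalizationIn S L).functionField L).toRingEquiv
  let := (functionFieldMap (fromNormalizationIn S L)).hom.toAlgebra
  refine Algebra.finrank_eq_of_equiv_equiv (RingEquiv.refl _) e ?_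
  refine IsLocalization.ringHom_ext (nonZeroDivisors Γ(S, V)) ?_
  ext a
  have h1 : algebraMap S.functionField (normalizationIn S L).functionField
      (algebraMap Γ(S, V) S.functionField a) =
      algebraMap _ (normalizationIn S L).functionField
        (algebraMap Γ(S, V) Γ(normalizationIn S L, fromNormalizationIn S L ⁻¹ᵁ V) a) :=
    congr($(germ_functionFieldMap (fromNormalizationIn S L) V hV') a)
  change algebraMap S.functionField L (algebraMap Γ(S, V) S.functionField a) =
    e (algebraMap S.functionField (normalizationIn S L).functionField
      (algebraMap Γ(S, V) S.functionField a))
  rw [h1, ← IsScalarTower.algebraMap_apply Γ(S, V) S.functionField L, IsScalarTower.algebraMap_apply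
    Γ(S, V) Γ(normalizationIn S L, fromNormalizationIn S L ⁻¹ᵁ V) L]
  exact ((IsLocalization.algEquiv _ _ L).commutes _).symm

theorem charZero_functionField {K : Type u} [Field K] [CharZero K] (s : S ⟶ Spec (.of K)) :
    CharZero S.functionField :=
  charZero_of_injective_ringHom (f := (Spec.preimage (S.fromSpecStalk (genericPoint S) ≫ s)).hom)
    (RingHom.injective _)

theorem isCover_fromNormalizationIn {K : Type u} [Field K] [CharZero K] {s : S ⟶ Spec (.of K)}
    (hS : IsNormalVariety s) [FiniteDimensional S.functionField L] :
    IsCover s (fromNormalizationIn S L) := by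
  have := hS.locallyOfFiniteType
  have := hS.isSeparated
  have := hS.quasiCompact
  have : IsLocallyNoetherian S := LocallyOfFiniteType.isLocallyNoetherian s
  have := charZero_functionField s
  have := isFinite_fromNormalizationIn (L := L) hS.isNormal
  exact
    { source := ⟨⟨inferInstance, inferInstance, inferInstance, inferInstance⟩,
        isNormal_normalizationIn⟩
      target := hS
      isFinite := this
      surjective := surjective_fromNormalizationIn }

theorem exists_fromNormalizationIn_lift (hV : IsAffineOpen V) {R : CommRingCat.{u}}
    (ψ : Γ(normalizationIn S L, fromNormalizationIn S L ⁻¹ᵁ V) ⟶ R) :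
    ∃ t : Spec R ⟶ normalizationIn S L,
      t ≫ fromNormalizationIn S L =
        Spec.map ((fromNormalizationIn S L).app V ≫ ψ) ≫ hV.fromSpec := by
  refine ⟨Spec.map ψ ≫ (hV.preimage (fromNormalizationIn S L)).fromSpec, ?_⟩
  rw [Category.assoc, ← IsAffineOpen.SpecMap_appLE_fromSpec (fromNormalizationIn S L) hV
    (hV.preimage _) le_rfl, ← Scheme.Hom.app_eq_appLE, Spec.map_comp, Category.assoc]

end NormalizationAlgebra

theorem finiteDimensional_of_isFractionRing (A F D L : Type*) [CommRing A] [IsDomain A]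
    [Field F] [Algebra A F] [IsFractionRing A F] [CommRing D] [IsDomain D] [Algebra A D]
    [Module.Finite A D] [Field L] [Algebra D L] [IsFractionRing D L] [Algebra A L]
    [IsScalarTower A D L] [Algebra F L] [IsScalarTower A F L] : FiniteDimensional F L := by
  obtain ⟨s, hs⟩ := (inferInstance : Module.Finite A D).fg_top
  classical
  refine ⟨s.image (algebraMap D L), top_unique fun x _ ↦ ?_⟩
  have hD (d : D) : algebraMap D L d ∈ Submodule.span F (s.image (algebraMap D L) : Set L) := by
    have hd : d ∈ Submodule.span A (s : Set D) := hs ▸ Submodule.mem_top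
    induction hd using Submodule.span_induction with
    | mem d hd => exact Submodule.subset_span (Finset.mem_coe.mpr (Finset.mem_image_of_mem _ hd))
    | zero => simp
    | add x y _ _ hx hy => simpa using add_mem hx hy
    | smul a x _ hx =>
      rw [Algebra.smul_def, map_mul, ← IsScalarTower.algebraMap_apply A D L,
        IsScalarTower.algebraMap_apply A F L, ← Algebra.smul_def]
      exact Submodule.smul_mem _ _ hx
  obtain ⟨d, e, he, rfl⟩ := IsFractionRing.div_surjective (A := D) x
  obtain ⟨a, ha, b, hb⟩ := (Algebra.IsIntegral.isIntegral (R := A) e).isAlgebraic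
    |>.exists_nonzero_dvd he
  have he0 : algebraMap D L e ≠ 0 := by simpa using nonZeroDivisors.ne_zero he
  have hab := congr(algebraMap D L $hb)
  rw [← IsScalarTower.algebraMap_apply, IsScalarTower.algebraMap_apply A F L, map_mul] at hab
  have ha0 : algebraMap A F a ≠ 0 := by simpa using ha
  have : algebraMap D L d / algebraMap D L e =
      (algebraMap A F a)⁻¹ • algebraMap D L (b * d) := by
    rw [Algebra.smul_def, map_inv₀, hab, map_mul]
    have : algebraMap D L b ≠ 0 := by
      rintro h
      rw [h, mul_zero] at hab
      exact ha0 (by simpa using hab)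
    field_simp
  rw [this]
  exact Submodule.smul_mem _ _ (hD _)

/-! ### Covers of `S` arising from a finite algebra without rational sections. -/

section Covers

variable {K : Type u} [Field K] [CharZero K] {S : Scheme.{u}} [IsIntegral S]
  {s : S ⟶ Spec (.of K)}

section

attribute [local instance] sectionsAlgebra normalizationInAlgebra normalizationInSectionsAlgebra

/-- `D` and the normalization over `U` have the same fraction field `L`, so a `K`-point of `D`
transfers to the normalization away from a common denominator `a`. -/
theorem exists_lift_of_isFractionRing (hS : IsNormalVariety s) {U : S.Opens} [Nonempty U]
    (hU : IsAffineOpen U) (L : Type u) [Field L] [Algebra S.functionField L]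
    [FiniteDimensional S.functionField L] (D : Type u) [CommRing D] [IsDomain D]
    [Algebra Γ(S, U) D] [Module.Finite Γ(S, U) D] [Algebra D L] [IsFractionRing D L]
    (h : (algebraMap S.functionField L).comp (algebraMap Γ(S, U) S.functionField) =
      (algebraMap D L).comp (algebraMap Γ(S, U) D)) :
    ∃ a : Γ(S, U), a ≠ 0 ∧ ∀ ψ : D →+* K, ψ (algebraMap _ _ a) ≠ 0 →
      ∃ t : Spec (.of K) ⟶ normalizationIn S L, t ≫ fromNormalizationIn S L =
        Spec.map (CommRingCat.ofHom (ψ.comp (algebraMap Γ(S, U) D))) ≫ hU.fromSpec := by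
  have : IsScalarTower Γ(S, U) D L := .of_algebraMap_eq' h
  have := hS.locallyOfFiniteType
  have : IsLocallyNoetherian S := LocallyOfFiniteType.isLocallyNoetherian s
  have := charZero_functionField s
  have := finite_normalizationIn (L := L) hU hS.isNormal
  obtain ⟨a, ha, H⟩ := exists_ne_zero_forall_exists_ringHom (A := Γ(S, U)) (D := D) (L := L)
    (C := Γ(normalizationIn S L, fromNormalizationIn S L ⁻¹ᵁ U))
  refine ⟨a, ha, fun φ hφ ↦ ?_⟩
  obtain ⟨ψ, hψ⟩ := H K φ hφ
  obtain ⟨t, ht⟩ := exists_fromNormalizationIn_lift hU (CommRingCat.ofHom ψ)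
  refine ⟨t, ht.trans ?_⟩
  rw [← hψ]
  rfl

end

theorem exists_cover_of_isPrime (hS : IsNormalVariety s) {U : S.Opens} [Nonempty U]
    (hU : IsAffineOpen U) {B : Type u} [CommRing B] [Algebra Γ(S, U) B] [Module.Finite Γ(S, U) B]
    (hB : IsEmpty (B →ₐ[Γ(S, U)] S.functionField)) (q : Ideal B) [q.IsPrime]
    (hq : q.comap (algebraMap Γ(S, U) B) = ⊥) :
    ∃ (T : Scheme.{u}) (π : T ⟶ S) (hc : IsCover s π), 1 < hc.degree ∧
      ∃ a : Γ(S, U), a ≠ 0 ∧ ∀ ψ : B →+* K, q ≤ RingHom.ker ψ → ψ (algebraMap _ _ a) ≠ 0 →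
        ∃ t : Spec (.of K) ⟶ T, t ≫ π = Spec.map (CommRingCat.ofHom
          (ψ.comp (algebraMap Γ(S, U) B))) ≫ hU.fromSpec := by
  have := functionField_isFractionRing_of_isAffineOpen S U hU
  let D := B ⧸ q
  let L := q.ResidueField
  have hAL : Function.Injective (algebraMap Γ(S, U) L) := by
    rw [injective_iff_map_eq_zero]
    intro a ha
    rw [IsScalarTower.algebraMap_apply Γ(S, U) B L, Ideal.algebraMap_residueField_eq_zero] at ha
    have : a ∈ q.comap (algebraMap Γ(S, U) B) := ha
    rwa [hq] at this
  let : Algebra S.functionField L := (IsFractionRing.lift hAL).toAlgebra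
  have hAFL : IsScalarTower Γ(S, U) S.functionField L := .of_algebraMap_eq fun a ↦
    (IsFractionRing.lift_algebraMap hAL a).symm
  have : IsScalarTower Γ(S, U) D L := .of_algebraMap_eq fun a ↦
    IsScalarTower.algebraMap_apply Γ(S, U) B L a
  have : FiniteDimensional S.functionField L :=
    finiteDimensional_of_isFractionRing Γ(S, U) S.functionField D L
  have hc := isCover_fromNormalizationIn (L := L) hS
  refine ⟨_, _, hc, ?_, ?_⟩
  · refine (?_ : 1 < Module.finrank S.functionField L).trans_eq
      (degree_fromNormalizationIn (S := S) (L := L)).symm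
    -- Degree 1 would identify `L` with `K(S)`, and `B → L` would become a rational section,
    -- excluded by `hB`.
    by_contra! hle
    have h1 : Module.finrank S.functionField L = 1 :=
      le_antisymm hle Module.finrank_pos
    have hbij : Function.Bijective (algebraMap S.functionField L)  := by
      refine ⟨RingHom.injective _, fun y ↦ ?_⟩
      obtain ⟨c, hc⟩ := (finrank_eq_one_iff_of_nonzero' (1 : L) one_ne_zero).mp h1 y
      exact ⟨c, by rw [← hc, Algebra.smul_def, mul_one]⟩
    let e : S.functionField ≃ₐ[Γ(S, U)] L :=
      AlgEquiv.ofBijective (IsScalarTower.toAlgHom Γ(S, U) S.functionField L) hbij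
    exact hB.false (e.symm.toAlgHom.comp (IsScalarTower.toAlgHom Γ(S, U) B L))
  · obtain ⟨a, ha, H⟩ := exists_lift_of_isFractionRing hS hU L D (by
      rw [← IsScalarTower.algebraMap_eq, ← IsScalarTower.algebraMap_eq])
    refine ⟨a, ha, fun ψ hψ hψa ↦ ?_⟩
    exact H (Ideal.Quotient.lift q ψ hψ) hψa

theorem exists_covers_of_finite (hS : IsNormalVariety s) {U : S.Opens} [Nonempty U]
    (hU : IsAffineOpen U) {B : Type u} [CommRing B] [Algebra Γ(S, U) B] [Module.Finite Γ(S, U) B]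
    (hB : IsEmpty (B →ₐ[Γ(S, U)] S.functionField)) :
    ∃ (ι : Type u) (_ : Finite ι) (T : ι → Scheme.{u}) (π : ∀ k, T k ⟶ S)
      (hc : ∀ k, IsCover s (π k)), (∀ k, 1 < (hc k).degree) ∧
      ∃ a : Γ(S, U), a ≠ 0 ∧ ∀ ψ : B →+* K, ψ (algebraMap _ _ a) ≠ 0 →
        ∃ (k : ι) (t : Spec (.of K) ⟶ T k), t ≫ π k = Spec.map (CommRingCat.ofHom
          (ψ.comp (algebraMap Γ(S, U) B))) ≫ hU.fromSpec := by
  have := hS.locallyOfFiniteType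
  have : IsLocallyNoetherian S := LocallyOfFiniteType.isLocallyNoetherian s
  have : IsNoetherianRing Γ(S, U) := IsLocallyNoetherian.component_noetherian ⟨U, hU⟩
  have : IsNoetherianRing B := IsNoetherianRing.of_finite Γ(S, U) B
  let ι := {q : Ideal B // q ∈ minimalPrimes B ∧ q.comap (algebraMap Γ(S, U) B) = ⊥}
  have hι : Finite ι :=
    ((minimalPrimes.finite_of_isNoetherianRing B).subset fun q hq ↦ hq.1).to_subtype
  have hprime (q : ι) : q.1.IsPrime := q.2.1.1.1
  choose T π hc hdeg a ha H using fun q : ι ↦ exists_cover_of_isPrime hS hU hB q.1 q.2.2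
  obtain ⟨b, hb, Hb⟩ := exists_ne_zero_forall_exists_minimalPrimes_le (A := Γ(S, U)) (B := B)
  have := Fintype.ofFinite ι
  -- The factor `b` discards points on no dominating component; each `a q` clears the denominators
  -- for one component.
  refine ⟨ι, hι, T, π, hc, hdeg, b * ∏ q, a q,
    mul_ne_zero hb (Finset.prod_ne_zero_iff.mpr fun q _ ↦ ha q), fun ψ hψ ↦ ?_⟩
  rw [map_mul, map_mul, mul_ne_zero_iff, map_prod, map_prod, Finset.prod_ne_zero_iff] at hψ
  obtain ⟨q, hq, hq0, hle⟩ := Hb (RingHom.ker ψ) (RingHom.ker_isPrime ψ) hψ.1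
  obtain ⟨t, ht⟩ := H ⟨q, hq, hq0⟩ ψ hle (hψ.2 _ (Finset.mem_univ _))
  exact ⟨_, t, ht⟩

end Covers

theorem IsThin.of_finite {K : Type u} [Field K] {X : Scheme.{u}} {s : X ⟶ Spec (.of K)}
    {T : Set (RationalPoint s)} {C : Scheme.{u}} (i : C ⟶ X) [IsClosedImmersion i]
    (hi : ¬ IsIso i) {ι : Type*} [Finite ι] {Z : ι → Scheme.{u}} (f : ∀ j, Z j ⟶ X)
    (hf : ∀ j, IsCover s (f j)) (hdeg : ∀ j, 1 < (hf j).degree)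
    (hT : T ⊆ Set.range (RationalPoint.map s i) ∪ ⋃ j, Set.range (RationalPoint.map s (f j))) :
    IsThin s T := by
  obtain ⟨n, ⟨e⟩⟩ := Finite.exists_equiv_fin ι
  refine ⟨C, i, n, fun j ↦ Z (e.symm j), fun j ↦ f (e.symm j), fun j ↦ hf _, inferInstance, hi,
    fun j ↦ hdeg _, hT.trans (Set.union_subset_union_right _ (Set.iUnion_subset fun j ↦ ?_))⟩
  obtain ⟨k, rfl⟩ := e.symm.surjective j
  exact Set.subset_iUnion_of_subset k le_rfl

/-- The base change of `i` along `x` is a surjective closed immersion into the reduced scheme `Spec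
K`, hence an isomorphism. -/
theorem exists_lift_of_isClosedImmersion {K : Type u} [Field K] {X D : Scheme.{u}} (i : D ⟶ X)
    [IsClosedImmersion i] (x : Spec (.of K) ⟶ X) (h : ∀ y, x y ∈ Set.range i) :
    ∃ d, d ≫ i = x := by
  have : Surjective (pullback.snd i x) := ⟨by
    rw [← Set.range_eq_univ, Scheme.Pullback.range_snd]
    exact Set.eq_univ_of_forall h⟩
  have := isIso_of_isClosedImmersion_of_surjective (pullback.snd i x)
  exact ⟨inv (pullback.snd i x) ≫ pullback.fst i x, by
    rw [Category.assoc, pullback.condition, IsIso.inv_hom_id_assoc]⟩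

theorem exists_isClosedImmersion_range_eq_compl {X : Scheme.{u}} (U : X.Opens) :
    ∃ (D : Scheme.{u}) (i : D ⟶ X), IsClosedImmersion i ∧ Set.range i = (U : Set X)ᶜ := by
  refine ⟨_, (Scheme.IdealSheafData.vanishingIdeal U.compl).subschemeι, inferInstance, ?_⟩
  rw [Scheme.IdealSheafData.range_subschemeι, Scheme.IdealSheafData.coe_support_vanishingIdeal]
  rfl

theorem SpecMap_germ_fromSpec {X : Scheme.{u}} {U : X.Opens} (hU : IsAffineOpen U) {x : X}
    (hx : x ∈ U) : Spec.map (X.presheaf.germ U x hx) ≫ hU.fromSpec = X.fromSpecStalk x :=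
  hU.fromSpecStalk_eq_fromSpecStalk hx

theorem exists_covers_of_isFinite {K : Type u} [Field K] [CharZero K] {S : Scheme.{u}}
    [IsIntegral S] {s : S ⟶ Spec (.of K)} (hS : IsNormalVariety s)
    {U : S.Opens} [Nonempty U] (hU : IsAffineOpen U) {W : Scheme.{u}} (q : W ⟶ Spec Γ(S, U))
    [IsFinite q]
    (hq : ∀ y : Spec S.functionField ⟶ W,
      y ≫ q ≫ hU.fromSpec ≠ S.fromSpecStalk (genericPoint S)) :
    ∃ (ι : Type u) (_ : Finite ι) (T : ι → Scheme.{u}) (π : ∀ k, T k ⟶ S)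
      (hc : ∀ k, IsCover s (π k)), (∀ k, 1 < (hc k).degree) ∧
      ∃ O : S.Opens, genericPoint S ∈ O ∧
        ∀ z : Spec (.of K) ⟶ W, (∀ x, (z ≫ q ≫ hU.fromSpec) x ∈ O) →
        ∃ (k : ι) (t : Spec (.of K) ⟶ T k), t ≫ π k = z ≫ q ≫ hU.fromSpec := by
  have hW : IsAffine W := isAffine_of_isAffineHom q
  let φ : Γ(S, U) ⟶ Γ(W, ⊤) := Spec.preimage (W.isoSpec.inv ≫ q)
  have hφ : Spec.map φ = W.isoSpec.inv ≫ q := Spec.map_preimage _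
  let := φ.hom.toAlgebra
  have hfin : Module.Finite Γ(S, U) Γ(W, ⊤) := by
    have : IsFinite (Spec.map φ) := hφ ▸ inferInstance
    exact (IsFinite.SpecMap_iff φ).mp this
  -- Such an algebra map is a point of `W` over the generic point of `S`, which `hq` forbids.
  have hB : IsEmpty (Γ(W, ⊤) →ₐ[Γ(S, U)] S.functionField) := ⟨fun y ↦ by
    let y' : Γ(W, ⊤) ⟶ S.functionField := CommRingCat.ofHom y.toRingHom
    refine hq (Spec.map y' ≫ W.isoSpec.inv) ?_
    rw [Category.assoc, ← reassoc_of% hφ, ← Spec.map_comp_assoc,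
      ← SpecMap_germ_fromSpec hU (genericPoint_mem_of_nonempty U)]
    congr 2
    ext a
    exact y.commutes a⟩
  obtain ⟨ι, hι, T, π, hc, hdeg, a, ha, H⟩ := exists_covers_of_finite hS hU hB
  refine ⟨ι, hι, T, π, hc, hdeg, S.basicOpen a, ?_, fun z hz ↦ ?_⟩
  · rw [Scheme.mem_basicOpen _ _ _ (genericPoint_mem_of_nonempty U)]
    refine IsUnit.mk0 _ fun h ↦ ha ?_
    exact (injective_iff_map_eq_zero _).mp (germ_injective_of_isIntegral _ _ _) _ h
  · let ψ : Γ(W, ⊤) ⟶ .of K := Spec.preimage (z ≫ W.isoSpec.hom)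
    have hψ : Spec.map ψ = z ≫ W.isoSpec.hom := Spec.map_preimage _
    have hzq : Spec.map (φ ≫ ψ) = z ≫ q := by
      rw [Spec.map_comp, hφ, hψ, Category.assoc, Iso.hom_inv_id_assoc]
    obtain ⟨k, t, ht⟩ := H ψ.hom fun h0 ↦ by
      obtain ⟨x⟩ : Nonempty (Spec (.of K)) := inferInstance
      have hx : Spec.map (φ ≫ ψ) x ∈ hU.fromSpec ⁻¹ᵁ S.basicOpen a := by
        rw [hzq]
        exact hz x
      rw [hU.fromSpec_preimage_basicOpen] at hx
      refine hx ?_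
      change (φ ≫ ψ) a ∈ x.asIdeal
      have : (φ ≫ ψ) a = 0 := h0
      rw [this]
      exact zero_mem _
    refine ⟨k, t, ht.trans ?_⟩
    rw [← Category.assoc, ← hzq]
    rfl

end HilbertProperty

/-! ### Spreading out and conclusion. -/

open HilbertProperty

theorem mainTheorem6 {K : Type u} [Field K] [CharZero K] {X S : Scheme.{u}}
    (sX : X ⟶ Spec (.of K)) (sS : S ⟶ Spec (.of K))
    (hX : HilbertProperty.IsNormalVariety sX) [IsIntegral S]
    (hS : HilbertProperty.IsNormalVariety sS)
    (p : X ⟶ S) (hp : p ≫ sS = sX) [IsDominant p]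
    (hSHP : HilbertProperty.HasHP sS)
    (hnormal : HilbertProperty.IsNormal (HilbertProperty.genericFiber p))
    (hHP : HilbertProperty.HasHP (HilbertProperty.genericFiberStructure p)) :
    HilbertProperty.HasHP sX := by
  rintro ⟨C, i, r, Z, f, hf, hi, hni, hdeg, hT⟩
  have := hX.isIntegral
  have := hS.isSeparated
  have := (hp ▸ hX.locallyOfFiniteType : LocallyOfFiniteType (p ≫ sS))
  have := (hp ▸ hX.quasiCompact : QuasiCompact (p ≫ sS))
  have := (hp ▸ hX.isSeparated : IsSeparated (p ≫ sS))
  have : LocallyOfFiniteType p := locallyOfFiniteType_of_comp p sS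
  have : QuasiCompact p := .of_comp p sS
  have : IsSeparated p := .of_comp p sS
  obtain ⟨x, hxp, hxC, hxf⟩ :=
    exists_rationalPoint_genericFiber hX p hnormal hHP i hni f hf hdeg
  obtain ⟨U, hηU, σ, hσx, hσp⟩ := spread_out_of_isGermInjective' (𝟙 S) p
    (x := genericPoint S) x (by rw [hxp, Category.comp_id])
  rw [Category.comp_id] at hσp
  have : Nonempty U := ⟨⟨_, hηU⟩⟩
  -- Otherwise `σ` factors through `C`, and so does its generic value `x`.
  have hgen : genericPoint U ∉ Set.range (pullback.snd i σ) := fun h ↦ by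
    have := isIso_of_genericPoint_mem_range _ h
    refine hxC (U.fromSpecStalkOfMem _ hηU ≫ inv (pullback.snd i σ) ≫ pullback.fst i σ) ?_
    simp only [Category.assoc]
    rw [pullback.condition, IsIso.inv_hom_id_assoc, hσx]
  let N : U.toScheme.Opens :=
    ⟨(Set.range (pullback.snd i σ))ᶜ, (pullback.snd i σ).isClosedMap.isClosed_range.isOpen_compl⟩
  have hηN : genericPoint S ∈ U.ι ''ᵁ N :=
    ⟨genericPoint U, hgen, genericPoint_eq_of_isOpenImmersion U.ι⟩
  obtain ⟨_, ⟨V, hV, rfl⟩, hηV, hVN⟩ :=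
    S.isBasis_affineOpens.exists_subset_of_mem_open hηN (U.ι ''ᵁ N).isOpen
  have hV : IsAffineOpen V := hV
  have : Nonempty V := ⟨⟨_, hηV⟩⟩
  have : IsOpenImmersion hV.fromSpec := hV.isOpenImmersion_fromSpec
  let τ : Spec Γ(S, V) ⟶ U := IsOpenImmersion.lift U.ι hV.fromSpec (by
    rw [hV.range_fromSpec, Scheme.Opens.range_ι]
    rintro y hy
    obtain ⟨y, -, rfl⟩ := hVN hy
    exact y.2)
  have hτ : τ ≫ U.ι = hV.fromSpec := IsOpenImmersion.lift_fac _ _ _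
  have hτN (y : Spec Γ(S, V)) : τ y ∉ Set.range (pullback.snd i σ) := by
    have : hV.fromSpec y ∈ (V : Set S) := hV.range_fromSpec ▸ Set.mem_range_self y
    obtain ⟨w, hw, hwy⟩ := hVN this
    rw [← hτ, Scheme.Hom.comp_apply] at hwy
    rwa [← U.ι.injective hwy]
  have hτη : Spec.map (S.presheaf.germ V _ hηV) ≫ τ = U.fromSpecStalkOfMem _ hηU := by
    rw [← cancel_mono U.ι, Category.assoc, hτ, SpecMap_germ_fromSpec,
      Scheme.Opens.fromSpecStalkOfMem_ι]
  -- A rational section of the pullback, projected to `Z j`, would be a lift of `x`.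
  have hno (j : Fin r) (y : Spec S.functionField ⟶ pullback (f j) (τ ≫ σ)) :
      y ≫ pullback.snd (f j) (τ ≫ σ) ≫ hV.fromSpec ≠ S.fromSpecStalk (genericPoint S) := by
    rw [← SpecMap_germ_fromSpec hV hηV, ← Category.assoc, Ne, cancel_mono]
    refine fun h ↦ hxf j (y ≫ pullback.fst _ _) ?_
    rw [Category.assoc, pullback.condition, reassoc_of% h, reassoc_of% hτη, hσx]
  have (j : Fin r) : IsFinite (f j) := (hf j).isFinite
  choose ι hι T π hc hcdeg O hηO H using fun j ↦ exists_covers_of_isFinite hS hV _ (hno j)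
  -- The complement `D` of `Ω` is the proper closed part in the thinness of `S(K)`; `K`-points of
  -- `Ω` must come from the covers `π`.
  let Ω : S.Opens := V ⊓ ⟨⋂ j, (O j : Set S), isOpen_iInter_of_finite fun j ↦ (O j).isOpen⟩
  have hηΩ : genericPoint S ∈ Ω := ⟨hηV, Set.mem_iInter.mpr hηO⟩
  obtain ⟨D, d, hd, hdΩ⟩ := exists_isClosedImmersion_range_eq_compl Ω
  refine hSHP (IsThin.of_finite d (fun h ↦ ?_) (fun k : Σ j, ι j ↦ π k.1 k.2)
    (fun k ↦ hc k.1 k.2) (fun k ↦ hcdeg k.1 k.2) fun s _ ↦ ?_)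
  · have : genericPoint S ∈ Set.range d := Set.range_eq_univ.mpr d.surjective ▸ Set.mem_univ _
    rw [hdΩ] at this
    exact this hηΩ
  by_cases hs : ∀ y, s.1 y ∈ Set.range d
  · obtain ⟨c, hcs⟩ := exists_lift_of_isClosedImmersion d s.1 hs
    exact Or.inl ⟨⟨c, by rw [reassoc_of% hcs]; exact s.2⟩, Subtype.ext hcs⟩
  have hs (y : Spec (.of K)) : s.1 y ∈ Ω := by
    obtain ⟨z, hz⟩ := not_forall.mp hs
    rw [hdΩ, Set.notMem_compl_iff] at hz
    have : Subsingleton (Spec (.of K)) := inferInstanceAs (Subsingleton (PrimeSpectrum K))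
    rwa [Subsingleton.elim y z]
  obtain ⟨v, hv⟩ : ∃ v, v ≫ hV.fromSpec = s.1 := ⟨IsOpenImmersion.lift hV.fromSpec s.1 (by
    rw [hV.range_fromSpec]
    rintro _ ⟨y, rfl⟩
    exact (hs y).1), IsOpenImmersion.lift_fac _ _ _⟩
  have hvX : (v ≫ τ ≫ σ) ≫ sX = 𝟙 _ := by
    rw [← hp, Category.assoc, Category.assoc, reassoc_of% hσp, reassoc_of% hτ, reassoc_of% hv]
    exact s.2
  -- The assumed thinness is applied to `σ(s)`. The case of `C` is impossible over `V`; in the other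
  -- case `(z, v)` is a `K`-point over `s` of the pullback of `Z j`.
  rcases hT (Set.mem_univ ⟨v ≫ τ ≫ σ, hvX⟩) with ⟨c, hcx⟩ | hz
  · have hcx : c.1 ≫ i = (v ≫ τ) ≫ σ := by
      rw [Category.assoc]
      exact congrArg Subtype.val hcx
    obtain ⟨y⟩ : Nonempty (Spec (.of K)) := inferInstance
    refine absurd ⟨pullback.lift c.1 (v ≫ τ) hcx y, ?_⟩ (hτN (v y))
    rw [← Scheme.Hom.comp_apply, pullback.lift_snd, Scheme.Hom.comp_apply]
  · obtain ⟨j, z, hz⟩ := Set.mem_iUnion.mp hz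
    have hz : z.1 ≫ f j = v ≫ τ ≫ σ := congrArg Subtype.val hz
    have hs' : pullback.lift z.1 v hz ≫ pullback.snd (f j) (τ ≫ σ) ≫ hV.fromSpec = s.1 := by
      rw [pullback.lift_snd_assoc, hv]
    obtain ⟨k, t, ht⟩ := H j (pullback.lift z.1 v hz) fun y ↦ by
      rw [hs']
      exact Set.mem_iInter.mp (hs y).2 j
    rw [hs'] at ht
    refine Or.inr (Set.mem_iUnion.mpr ⟨⟨j, k⟩, ⟨t, ?_⟩, Subtype.ext ht⟩)
    rw [reassoc_of% ht]
    exact s.2
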